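/- Write $\widehat{\mathbb Z}=\prod_\ell \mathbb Z_\ell$, the product over all primes $\ell$, with the product topology. For a commutative ring $R$ let $$\operatorname{GSp}_4(R)=\{g\in \operatorname{GL}_4(R) : g^{T}Jg=\mu J \text{ for some } \mu\in R^\times\},\qquad J=\begin{pmatrix}0&-I_2\\ I_2&0\end{pmatrix},$$ let $\operatorname{mult}\colon \operatorname{GSp}_4(R)\to R^\times$ be the homomorphism sending $g$ to its (unique) multiplier $\mu$, and let $\operatorname{Sp}_4(R)=\ker(\operatorname{mult})$. For each prime $\ell$ let $\pi_\ell\colon \operatorname{GSp}_4(\widehat{\mathbb Z})\to \operatorname{GSp}_4(\mathbb Z_\ell)$ be the projection onto the $\ell$-adic factor. Let $\operatorname{sgn}\colon \operatorname{GSp}_4(\widehat{\mathbb Z})\to\{\pm1\}$ be the composition of the reduction $\operatorname{GSp}_4(\widehat{\mathbb Z})\to\operatorname{GSp}_4(\mathbb Z/2\mathbb Z)$ with the sign character of $\operatorname{GSp}_4(\mathbb Z/2\mathbb Z)\simeq S_6$, where $S_6$ acts on the four-dimensional symplectic $\mathbb F_2$-space of even-size subsets of $\{1,\dots,6\}$ (under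 symmetric difference) modulo the full set, with the form $(S,T)\mapsto |S\cap T| \bmod 2$. **Lemma 2.1.** Let $H\subseteq \operatorname{GSp}_4(\widehat{\mathbb Z})$ be a closed subgroup such that 1. $\pi_\ell(H)\supseteq \operatorname{Sp}_4(\mathbb Z_\ell)$ for every prime $\ell$; 2. the map $(\operatorname{sgn},\operatorname{mult})\colon \operatorname{GSp}_4(\widehat{\mathbb Z})\to\{\pm1\}\times\widehat{\mathbb Z}^\times$ remains surjective when restricted to $H$. Then $H=\operatorname{GSp}_4(\widehat{\mathbb Z})$. -/

import Mathlib

open Matrix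

/-- The general symplectic group `GSp₄(R)`: all `g ∈ GL₄(R)` with `gᵀ J g = μ J` for some unit
`μ ∈ Rˣ`, where `J = (0, -1; 1, 0)` is the Gram matrix of the standard symplectic form. The four
basis vectors are indexed by `Fin 2 ⊕ Fin 2`. -/
def GSp4 (R : Type*) [CommRing R] : Subgroup (GL (Fin 2 ⊕ Fin 2) R) where
  carrier := {g | ∃ μ : Rˣ, g.valᵀ * J (Fin 2) R * g.val = (μ : R) • J (Fin 2) R}
  one_mem' := ⟨1, by simp⟩
  mul_mem' := by
    rintro a b ⟨μ, ha⟩ ⟨ν, hb⟩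
    refine ⟨μ * ν, ?_⟩
    calc (a * b).valᵀ * J (Fin 2) R * (a * b).val
        = b.valᵀ * (a.valᵀ * J (Fin 2) R * a.val) * b.val := by
          simp only [Units.val_mul, transpose_mul, Matrix.mul_assoc]
      _ = ((μ * ν : Rˣ) : R) • J (Fin 2) R := by
          rw [ha, Matrix.mul_smul, Matrix.smul_mul, hb, smul_smul, Units.val_mul]
  inv_mem' := by
    rintro a ⟨μ, ha⟩
    refine ⟨μ⁻¹, ?_⟩
    have h1 : a.val * a⁻¹.val = 1 := a.mul_inv
    have h2 : a⁻¹.valᵀ * a.valᵀ = 1 := by rw [← transpose_mul, h1, transpose_one]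
    have h3 : (μ : R) • (a⁻¹.valᵀ * J (Fin 2) R * a⁻¹.val) = J (Fin 2) R := by
      calc (μ : R) • (a⁻¹.valᵀ * J (Fin 2) R * a⁻¹.val)
          = a⁻¹.valᵀ * ((μ : R) • J (Fin 2) R) * a⁻¹.val := by
            rw [Matrix.mul_smul, Matrix.smul_mul]
        _ = (a⁻¹.valᵀ * a.valᵀ) * J (Fin 2) R * (a.val * a⁻¹.val) := by
            rw [← ha]; simp only [Matrix.mul_assoc]
        _ = J (Fin 2) R := by rw [h1, h2, Matrix.one_mul, Matrix.mul_one]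
    calc a⁻¹.valᵀ * J (Fin 2) R * a⁻¹.val
        = ((μ⁻¹ : Rˣ) : R) • ((μ : R) • (a⁻¹.valᵀ * J (Fin 2) R * a⁻¹.val)) := by
          rw [smul_smul, Units.inv_mul, one_smul]
      _ = _ := by rw [h3]

namespace GSp4

section Ring

variable {R S : Type*} [CommRing R] [CommRing S]

theorem multiplier_unique {μ ν : R} (h : μ • J (Fin 2) R = ν • J (Fin 2) R) : μ = ν := by
  have := congrFun (congrFun h (Sum.inr 0)) (Sum.inl 0)
  simpa [J] using this

/-- The multiplier character `mult : GSp₄(R) → Rˣ`; `mult g` is the unique unit `μ` with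
`gᵀ J g = μ J`. -/
noncomputable def mult : GSp4 R →* Rˣ where
  toFun g := g.2.choose
  map_one' := by
    apply Units.ext
    apply multiplier_unique (R := R)
    rw [← (1 : GSp4 R).2.choose_spec]
    simp
  map_mul' a b := by
    apply Units.ext
    apply multiplier_unique (R := R)
    have ha := a.2.choose_spec
    have hb := b.2.choose_spec
    rw [← (a * b).2.choose_spec]
    generalize a.2.choose = μ at *
    generalize b.2.choose = ν at *
    calc (a * b).1.valᵀ * J (Fin 2) R * (a * b).1.val
        = b.1.valᵀ * (a.1.valᵀ * J (Fin 2) R * a.1.val) * b.1.val := by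
          simp only [Subgroup.coe_mul, Units.val_mul, transpose_mul, Matrix.mul_assoc]
      _ = ((μ * ν : Rˣ) : R) • J (Fin 2) R := by
          rw [ha, Matrix.mul_smul, Matrix.smul_mul, hb, smul_smul, Units.val_mul]

theorem mult_spec (g : GSp4 R) :
    g.1.valᵀ * J (Fin 2) R * g.1.val = ((mult g : Rˣ) : R) • J (Fin 2) R :=
  g.2.choose_spec

/-- Functoriality: the homomorphism `GSp₄(R) → GSp₄(S)` applying a ring homomorphism `R → S` to
every matrix entry. -/
def map (f : R →+* S) : GSp4 R →* GSp4 S :=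
  ((GeneralLinearGroup.map f).comp (GSp4 R).subtype).codRestrict (GSp4 S) (by
    rintro ⟨g, μ, h⟩
    refine ⟨Units.map f.toMonoidHom μ, ?_⟩
    have h' := congrArg (fun M => M.map f) h
    simp only [Matrix.map_mul, Matrix.transpose_map, map_J] at h'
    refine h'.trans ?_
    ext i j
    have hJ := congrFun (congrFun (map_J (Fin 2) f) i) j
    simp only [Matrix.map_apply] at hJ
    simp [hJ])

end Ring

/-- `Sp₄(R)`, the kernel of the multiplier character. -/
noncomputable def Sp4 (R : Type*) [CommRing R] : Subgroup (GSp4 R) := (mult (R := R)).ker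

/-! ### The identification `GSp₄(𝔽₂) ≃ S₆`

Let `V` be the group of subsets of even size of a set of six points (under symmetric difference),
modulo the full set, with the form `(S, T) ↦ |S ∩ T| mod 2`. It is a symplectic space of dimension
four over `𝔽₂`. We identify `V` with `𝔽₂⁴` so that the class of `{i, j}` is the vector
`pt i + pt j`. A permutation `σ` acts on `V` by `{i, j} ↦ {σ i, σ j}`. -/

namespace ModTwo

/-- Six vectors in `𝔽₂⁴` such that the class of `{i, j}` is `pt i + pt j`. -/
def pt (i : Fin 6) : Fin 2 ⊕ Fin 2 → ZMod 2 :=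
  Sum.elim
    ![![1, 0, 1, 1, 1, 0] i, ![0, 0, 1, 0, 1, 0] i]
    ![![0, 1, 1, 1, 1, 0] i, ![0, 0, 0, 1, 1, 0] i]

/-- The matrix whose columns are the classes of `{σ i, σ 5}` for `i = 0, 1, 2, 3`. -/
def colMat (σ : Fin 6 → Fin 6) : Matrix (Fin 2 ⊕ Fin 2) (Fin 4) (ZMod 2) :=
  fun r i => pt (σ i.castSucc.castSucc) r + pt (σ 5) r

/-- The inverse of `colMat id`. -/
def colInv : Matrix (Fin 4) (Fin 2 ⊕ Fin 2) (ZMod 2) :=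
  fun i => Sum.elim ![![1, 0, 0, 0] i, ![1, 1, 1, 0] i] ![![0, 1, 0, 0] i, ![1, 1, 0, 1] i]

/-- The matrix of the action of the permutation `σ` on `V ≃ 𝔽₂⁴`. -/
def permMat (σ : Equiv.Perm (Fin 6)) : Matrix (Fin 2 ⊕ Fin 2) (Fin 2 ⊕ Fin 2) (ZMod 2) :=
  colMat σ * colInv

theorem colMat_mul_colInv : colMat id * colInv = 1 := by decide

theorem colInv_mul_colMat : colInv * colMat id = 1 := by decide

theorem permMat_mul_colMat_id (σ : Equiv.Perm (Fin 6)) : permMat σ * colMat id = colMat σ := by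
  rw [permMat, Matrix.mul_assoc, colInv_mul_colMat, Matrix.mul_one]

theorem sum_pt (r : Fin 2 ⊕ Fin 2) : ∑ i, pt i r = 0 := by revert r; decide

/-- `permMat σ` sends the class of `{i, 5}` to that of `{σ i, σ 5}`. -/
theorem permMat_mulVec (σ : Equiv.Perm (Fin 6)) (i : Fin 6) :
    permMat σ *ᵥ pt i = pt (σ i) + pt (σ 5) := by
  have key : ∀ k : Fin 4,
      permMat σ *ᵥ pt k.castSucc.castSucc = pt (σ k.castSucc.castSucc) + pt (σ 5) := by
    intro k
    ext r
    have h := congrFun (congrFun (permMat_mul_colMat_id σ) r) k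
    have h5 : ∀ s, pt 5 s = 0 := by decide
    have hk : (fun s => colMat id s k) = pt k.castSucc.castSucc := by
      ext s; simp [colMat, h5]
    have : (permMat σ * colMat id) r k = (permMat σ *ᵥ (fun s => colMat id s k)) r := rfl
    rw [this, hk] at h
    exact h
  have h0 : permMat σ *ᵥ pt 0 = _ := key 0
  have h1 : permMat σ *ᵥ pt 1 = _ := key 1
  have h2 : permMat σ *ᵥ pt 2 = _ := key 2
  have h3 : permMat σ *ᵥ pt 3 = _ := key 3
  have h4 : pt 4 = pt 0 + pt 1 + pt 2 + pt 3 := by decide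
  have h5 : pt 5 = 0 := by decide
  have two : ∀ a : ZMod 2, a + a = 0 := by decide
  have hs : ∀ r, pt (σ 0) r + pt (σ 1) r + pt (σ 2) r + pt (σ 3) r + pt (σ 4) r + pt (σ 5) r
      = 0 := by
    intro r
    rw [← sum_pt r, ← Equiv.sum_comp σ (fun i => pt i r)]
    simp [Fin.sum_univ_succ]
    ring
  fin_cases i
  · exact h0
  · exact h1
  · exact h2
  · exact h3
  · show permMat σ *ᵥ pt 4 = pt (σ 4) + pt (σ 5)
    rw [h4, mulVec_add, mulVec_add, mulVec_add, h0, h1, h2, h3]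
    ext r
    have := hs r
    simp only [Pi.add_apply]
    show pt (σ 0) r + pt (σ 5) r + (pt (σ 1) r + pt (σ 5) r) + (pt (σ 2) r + pt (σ 5) r)
      + (pt (σ 3) r + pt (σ 5) r) = _
    generalize pt (σ 0) r = a0 at *
    generalize pt (σ 1) r = a1 at *
    generalize pt (σ 2) r = a2 at *
    generalize pt (σ 3) r = a3 at *
    generalize pt (σ 4) r = a4 at *
    generalize pt (σ 5) r = a5 at *
    revert a0 a1 a2 a3 a4 a5
    decide
  · show permMat σ *ᵥ pt 5 = pt (σ 5) + pt (σ 5)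
    rw [h5, mulVec_zero]
    ext r
    exact (two _).symm

theorem permMat_mul (σ τ : Equiv.Perm (Fin 6)) : permMat (σ * τ) = permMat σ * permMat τ := by
  have : colMat (σ * τ : Equiv.Perm (Fin 6)) = permMat σ * colMat τ := by
    ext r k
    have h : (permMat σ * colMat τ) r k
        = (permMat σ *ᵥ (pt (τ k.castSucc.castSucc) + pt (τ 5))) r := rfl
    rw [h, mulVec_add, permMat_mulVec, permMat_mulVec]
    simp only [colMat, Equiv.Perm.coe_mul, Function.comp_apply, Pi.add_apply]
    generalize pt (σ (τ k.castSucc.castSucc)) r = a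
    generalize pt (σ (τ 5)) r = b
    generalize pt (σ 5) r = c
    revert a b c
    decide
  rw [permMat, this, Matrix.mul_assoc]
  rfl

theorem permMat_one : permMat 1 = 1 := colMat_mul_colInv

/-- The symplectic form on `𝔽₂⁴`, in coordinates. -/
def form (x y : Fin 2 ⊕ Fin 2 → ZMod 2) : ZMod 2 :=
  x (.inl 0) * y (.inr 0) + x (.inl 1) * y (.inr 1) + x (.inr 0) * y (.inl 0)
    + x (.inr 1) * y (.inl 1)

theorem transpose_J_mul_apply {m : Type*} [Fintype m]
    (A : Matrix (Fin 2 ⊕ Fin 2) m (ZMod 2)) (i j : m) :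
    (Aᵀ * J (Fin 2) (ZMod 2) * A) i j = form (fun r => A r i) (fun r => A r j) := by
  have neg : ∀ a : ZMod 2, -a = a := by decide
  simp [Matrix.mul_apply, J, form, Fin.sum_univ_succ, neg, Matrix.one_apply]
  ring

theorem form_pt : ∀ a b c : Fin 6, a ≠ c → b ≠ c →
    form (pt a + pt c) (pt b + pt c) = if a = b then 0 else 1 := by decide +kernel

theorem colMat_gram (σ : Equiv.Perm (Fin 6)) :
    (colMat σ)ᵀ * J (Fin 2) (ZMod 2) * colMat σ
      = (colMat id)ᵀ * J (Fin 2) (ZMod 2) * colMat id := by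
  have key : ∀ τ : Equiv.Perm (Fin 6), ∀ i j,
      ((colMat τ)ᵀ * J (Fin 2) (ZMod 2) * colMat τ) i j = if i = j then 0 else 1 := by
    intro τ i j
    rw [transpose_J_mul_apply]
    have hne : ∀ k : Fin 4, (k.castSucc.castSucc : Fin 6) ≠ 5 := by decide
    have := form_pt (τ i.castSucc.castSucc) (τ j.castSucc.castSucc) (τ 5)
      (τ.injective.ne (hne i)) (τ.injective.ne (hne j))
    refine Eq.trans this ?_
    simp [τ.injective.eq_iff]
  ext i j
  rw [key σ, ← key 1]
  rfl

theorem permMat_symplectic (σ : Equiv.Perm (Fin 6)) :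
    (permMat σ)ᵀ * J (Fin 2) (ZMod 2) * permMat σ = J (Fin 2) (ZMod 2) := by
  calc (permMat σ)ᵀ * J (Fin 2) (ZMod 2) * permMat σ
      = colInvᵀ * ((colMat σ)ᵀ * J (Fin 2) (ZMod 2) * colMat σ) * colInv := by
        simp only [permMat, transpose_mul, Matrix.mul_assoc]
    _ = (colMat id * colInv)ᵀ * J (Fin 2) (ZMod 2) * (colMat id * colInv) := by
        rw [colMat_gram]; simp only [transpose_mul, Matrix.mul_assoc]
    _ = J (Fin 2) (ZMod 2) := by rw [colMat_mul_colInv]; simp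

/-- The action of `S₆` on `V ≃ 𝔽₂⁴`, as a homomorphism `S₆ → GSp₄(𝔽₂)`. -/
def permHom : Equiv.Perm (Fin 6) →* GSp4 (ZMod 2) where
  toFun σ := ⟨⟨permMat σ, permMat σ⁻¹, by rw [← permMat_mul, mul_inv_cancel, permMat_one],
    by rw [← permMat_mul, inv_mul_cancel, permMat_one]⟩, 1, by simpa using permMat_symplectic σ⟩
  map_one' := by ext1; ext1; exact permMat_one
  map_mul' σ τ := by ext1; ext1; exact permMat_mul σ τ

theorem pt_add_pt : ∀ a b c d : Fin 6, c ≠ d → pt a + pt b = pt c + pt d →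
    (a = c ∧ b = d) ∨ (a = d ∧ b = c) := by decide +kernel

theorem permHom_injective : Function.Injective permHom := by
  rw [injective_iff_map_eq_one]
  intro σ h
  have hM : permMat σ = 1 := congrArg (fun g : GSp4 (ZMod 2) => g.1.val) h
  have h1 : ∀ i, pt (σ i) + pt (σ 5) = pt i + pt 5 := by
    intro i
    rw [← permMat_mulVec, hM, one_mulVec, show pt 5 = 0 by decide, add_zero]
  have h2 : ∀ i, i ≠ 5 → (σ i = i ∧ σ 5 = 5) ∨ (σ i = 5 ∧ σ 5 = i) :=
    fun i hi => pt_add_pt _ _ _ _ hi (h1 i)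
  have h5 : σ 5 = 5 := by
    rcases h2 0 (by decide) with h | h
    · exact h.2
    · rcases h2 1 (by decide) with h' | h'
      · exact h'.2
      · exact absurd (h.2.symm.trans h'.2) (by decide)
  ext1 i
  by_cases hi : i = 5
  · rw [hi]; exact h5
  · rcases h2 i hi with h | h
    · exact h.1
    · exact absurd (h.2.symm.trans h5) hi

theorem exists_common : ∀ x y, form x y = 1 →
    ∃ t a b : Fin 6, x = pt a + pt t ∧ y = pt b + pt t := by
  decide +kernel

theorem eq_add_or_exists : ∀ t a b : Fin 6, form (pt a + pt t) (pt b + pt t) = 1 →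
    ∀ z, form (pt a + pt t) z = 1 → form (pt b + pt t) z = 1 →
    z = pt a + pt t + (pt b + pt t) ∨ ∃ c, z = pt c + pt t := by
  decide +kernel

theorem exists_center (x y z w : Fin 2 ⊕ Fin 2 → ZMod 2) (hxy : form x y = 1)
    (hxz : form x z = 1) (hyz : form y z = 1) (hxw : form x w = 1) (hyw : form y w = 1)
    (hzw : form z w = 1) :
    ∃ t : Fin 6, ∀ s : Fin 6, ∃ q : Fin 6, ![x, y, z, w, x + y + z + w, 0] s = pt q + pt t := by
  have add : ∀ u v v', form u (v + v') = form u v + form u v' := by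
    intro u v v'; simp only [form, Pi.add_apply]; ring
  have comm : ∀ u v, form u v = form v u := by
    intro u v; simp only [form]; ring
  have self : ∀ u, form u u = 0 := by decide +kernel
  have two : ∀ a : ZMod 2, a + a = 0 := by decide
  have step : ∀ v v', form x v = 1 → form y v = 1 → form v v' = 1 → form x v' = 1 →
      form y v' = 1 → v ≠ x + y := by
    rintro v v' - - h h1 h2 rfl
    rw [comm, add, comm, h1, comm, h2, two] at h
    exact absurd h (by decide)
  obtain ⟨t, a, b, hx, hy⟩ := exists_common x y hxy
  have star : ∀ v v', form x v = 1 → form y v = 1 → form v v' = 1 → form x v' = 1 →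
      form y v' = 1 → ∃ c, v = pt c + pt t := by
    intro v v' h1 h2 h3 h4 h5
    refine (eq_add_or_exists t a b ?_ v ?_ ?_).resolve_left ?_
    · rw [← hx, ← hy]; exact hxy
    · rw [← hx]; exact h1
    · rw [← hy]; exact h2
    · rw [← hx, ← hy]; exact step v v' h1 h2 h3 h4 h5
  have hxs : form x (x + y + z + w) = 1 := by
    simp only [add, self, hxy, hxz, hxw]; decide
  have hys : form y (x + y + z + w) = 1 := by
    simp only [add, self, comm y x, hxy, hyz, hyw]; decide
  have hzs : form z (x + y + z + w) = 1 := by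
    simp only [add, self, comm z x, comm z y, hxz, hyz, hzw]; decide
  refine ⟨t, fun s => ?_⟩
  fin_cases s
  · exact ⟨a, hx⟩
  · exact ⟨b, hy⟩
  · exact star z w hxz hyz hzw hxw hyw
  · exact star w z hxw hyw (by rw [comm]; exact hzw) hxz hyz
  · exact star _ z hxs hys (by rw [comm]; exact hzs) hxz hyz
  · exact ⟨t, by ext r; exact (two _).symm⟩

theorem pt_injective : Function.Injective pt := by decide +kernel

theorem permHom_surjective : Function.Surjective permHom := by
  rintro ⟨g, μ, hg⟩
  have hμ : μ = 1 := Subsingleton.elim _ _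
  rw [hμ, Units.val_one, one_smul] at hg
  have hgram : (g.val * colMat id)ᵀ * J (Fin 2) (ZMod 2) * (g.val * colMat id)
      = (colMat id)ᵀ * J (Fin 2) (ZMod 2) * colMat id := by
    calc (g.val * colMat id)ᵀ * J (Fin 2) (ZMod 2) * (g.val * colMat id)
        = (colMat id)ᵀ * (g.valᵀ * J (Fin 2) (ZMod 2) * g.val) * colMat id := by
          simp only [transpose_mul, Matrix.mul_assoc]
      _ = _ := by rw [hg]
  have h5 : pt 5 = 0 := by decide
  have hcol : ∀ k : Fin 4, (fun r => colMat id r k) = pt k.castSucc.castSucc := by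
    intro k; ext r; simp [colMat, h5]
  have hform : ∀ i j : Fin 4, form (g.val *ᵥ pt i.castSucc.castSucc)
      (g.val *ᵥ pt j.castSucc.castSucc)
      = form (pt i.castSucc.castSucc) (pt j.castSucc.castSucc) := by
    intro i j
    have h := congrFun (congrFun hgram i) j
    rw [transpose_J_mul_apply, transpose_J_mul_apply, hcol, hcol] at h
    rw [← hcol i, ← hcol j] at h ⊢
    exact h
  obtain ⟨t, ht⟩ := exists_center (g.val *ᵥ pt 0) (g.val *ᵥ pt 1) (g.val *ᵥ pt 2)
    (g.val *ᵥ pt 3) ((hform 0 1).trans (by decide))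
    ((hform 0 2).trans (by decide)) ((hform 1 2).trans (by decide)) ((hform 0 3).trans (by decide)) ((hform 1 3).trans (by decide))
    ((hform 2 3).trans (by decide))
  have ht' : ∀ s : Fin 6, ∃ q : Fin 6, g.val *ᵥ pt s = pt q + pt t := by
    intro s
    obtain ⟨q, hq⟩ := ht s
    refine ⟨q, hq ▸ ?_⟩
    have h4 : pt 4 = pt 0 + pt 1 + pt 2 + pt 3 := by decide
    fin_cases s
    · rfl
    · rfl
    · rfl
    · rfl
    · show g.val *ᵥ pt 4 = g.val *ᵥ pt 0 + g.val *ᵥ pt 1 + g.val *ᵥ pt 2 + g.val *ᵥ pt 3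
      rw [h4, mulVec_add, mulVec_add, mulVec_add]
    · show g.val *ᵥ pt 5 = 0
      rw [h5, mulVec_zero]
  choose f hf using ht'
  have hf5 : f 5 = t := by
    have h := hf 5
    have hz : ∀ a b : Fin 6, 0 = pt a + pt b → a = b := by decide +kernel
    rw [h5, mulVec_zero] at h
    exact hz _ _ h
  have hinj : Function.Injective f := by
    intro a b hab
    have h : g.val *ᵥ pt a = g.val *ᵥ pt b := by rw [hf, hf, hab]
    have h' := congrArg (fun v => g⁻¹.val *ᵥ v) h
    simp only [mulVec_mulVec, Units.inv_mul, one_mulVec] at h'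
    exact pt_injective h'
  let σ : Equiv.Perm (Fin 6) := Equiv.ofBijective f (Finite.injective_iff_bijective.mp hinj)
  refine ⟨σ, ?_⟩
  have hc : colMat σ = g.val * colMat id := by
    ext r k
    have h : (g.val * colMat id) r k = (g.val *ᵥ (fun s => colMat id s k)) r := rfl
    rw [h, hcol, hf, ← hf5]
    rfl
  ext1
  ext1
  show permMat σ = g.val
  rw [permMat, hc, Matrix.mul_assoc, colMat_mul_colInv, Matrix.mul_one]

end ModTwo

/-- The identification `GSp₄(𝔽₂) ≃ S₆`, inverse to the action of `S₆` on `V ≃ 𝔽₂⁴`. -/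
noncomputable def equivS6 : GSp4 (ZMod 2) ≃* Equiv.Perm (Fin 6) :=
  (MulEquiv.ofBijective ModTwo.permHom
    ⟨ModTwo.permHom_injective, ModTwo.permHom_surjective⟩).symm

end GSp4

instance Nat.Primes.fact_prime_coe (p : Nat.Primes) : Fact (p : ℕ).Prime := ⟨p.2⟩

/-- The ring `Ẑ = ∏_ℓ ℤ_ℓ` of profinite integers, a topological ring for the product topology.
Then `GSp4 ZHat` is a topological group: it is a subgroup of `GL₄(Ẑ)`, the unit group of the
topological ring of matrices over `Ẑ`. -/
abbrev ZHat : Type := (p : Nat.Primes) → ℤ_[(p : ℕ)]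

namespace GSp4

/-- The projection `π_ℓ : GSp₄(Ẑ) → GSp₄(ℤ_ℓ)`. -/
noncomputable def proj (p : Nat.Primes) : GSp4 ZHat →* GSp4 ℤ_[(p : ℕ)] :=
  map (Pi.evalRingHom (fun q : Nat.Primes => ℤ_[(q : ℕ)]) p)

/-- The reduction map `Ẑ → ℤ/2ℤ`. -/
noncomputable def zHatModTwo : ZHat →+* ZMod 2 :=
  (PadicInt.toZMod (p := 2)).comp
    (Pi.evalRingHom (fun q : Nat.Primes => ℤ_[(q : ℕ)]) ⟨2, Nat.prime_two⟩)

/-- The character `sgn : GSp₄(Ẑ) → {±1}`: reduction mod `2`, followed by the sign of the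
corresponding permutation in `S₆`. -/
noncomputable def sgn : GSp4 ZHat →* ℤˣ :=
  Equiv.Perm.sign.comp (equivS6.toMonoidHom.comp (map zHatModTwo))

end GSp4

/-! The proof separates the primes by means of commutators. Surjectivity of `mult` on H and the
first hypothesis make H surject onto every factor GSp₄(ℤ_ℓ) (`exists_proj_eq`); what remains is to
find elements of H concentrated at a single prime, to any finite precision.

Over a local ring Sp₄ is generated by transvections, and a normal subgroup of GSp₄ containing one
`heis 0 b 0` with b a unit contains them all (`Sp4_le_of_heis_mem`). Hence the commutator subgroup
of GSp₄(ℤ_ℓ) contains Sp₄(ℤ_ℓ) for odd ℓ, and the kernel of the sign on Sp₄(ℤ₂) for ℓ = 2. An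
element with trivial `sgn` and `mult` therefore has all its components in the commutator subgroups,
and by the second hypothesis it suffices that H contain these, one factor at a time.

The separation rests on an asymmetry: for p < ℓ the ℓ-subgroups of GSp₄(ℤ/pᵏ) are abelian, because
ℓ³ does not divide the order of GL₄(𝔽_p), whereas the Heisenberg group modulo ℓᵏ is an ℓ-group with
commutator `heis 0 2 0`. Lifting it into a Sylow ℓ-subgroup of a finite image of H and taking
commutators gives that element at ℓ with trivial components at all smaller primes; conjugation
enlarges it to Sp₄(ℤ_ℓ) for odd ℓ (`exists_approx_Sp4`). An induction over the primes
(`containsCommutators`) then shows that H is dense. -/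

open scoped commutatorElement

namespace GSp4

/-! ### Transvections and the Heisenberg group -/

section Symplectic

variable {R S : Type*} [CommRing R] [CommRing S]

theorem mult_eq_of_spec {g : GSp4 R} {μ : Rˣ}
    (h : g.1.valᵀ * J (Fin 2) R * g.1.val = (μ : R) • J (Fin 2) R) : mult g = μ :=
  Units.ext (multiplier_unique ((mult_spec g).symm.trans h))

theorem mem_Sp4_iff {g : GSp4 R} : g ∈ Sp4 R ↔ mult g = 1 := MonoidHom.mem_ker

theorem mult_map (f : R →+* S) (g : GSp4 R) : mult (map f g) = Units.map f.toMonoidHom (mult g) := by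
  apply mult_eq_of_spec
  have h' := congrArg (fun M => M.map f) (mult_spec g)
  simp only [Matrix.map_mul, Matrix.transpose_map, map_J] at h'
  refine h'.trans ?_
  ext i j
  have hJ := congrFun (congrFun (map_J (Fin 2) f) i) j
  simp only [Matrix.map_apply] at hJ
  simp [hJ]

theorem map_val (f : R →+* S) (g : GSp4 R) : (map f g).1.val = g.1.val.map f := rfl

@[ext]
theorem ext_val {g h : GSp4 R} (H : g.1.val = h.1.val) : g = h := Subtype.ext (Units.ext H)

theorem mul_val (g h : GSp4 R) : (g * h).1.val = g.1.val * h.1.val := rfl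

/-- The standard symplectic form on `R⁴`. -/
def bil (x y : Fin 2 ⊕ Fin 2 → R) : R :=
  x (.inr 0) * y (.inl 0) + x (.inr 1) * y (.inl 1) - x (.inl 0) * y (.inr 0)
    - x (.inl 1) * y (.inr 1)

theorem bil_eq (x y : Fin 2 ⊕ Fin 2 → R) : bil x y = x ⬝ᵥ (J (Fin 2) R *ᵥ y) := by
  simp [bil, dotProduct, mulVec, J, Matrix.one_apply]
  ring

theorem bil_mulVec (g : GSp4 R) (x y : Fin 2 ⊕ Fin 2 → R) :
    bil (g.1.val *ᵥ x) (g.1.val *ᵥ y) = mult g * bil x y := by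
  have : g.1.valᵀ *ᵥ (J (Fin 2) R *ᵥ (g.1.val *ᵥ y)) = (mult g : R) • (J (Fin 2) R *ᵥ y) := by
    rw [mulVec_mulVec, mulVec_mulVec, mult_spec, smul_mulVec]
  rw [bil_eq, bil_eq, ← smul_eq_mul, ← dotProduct_smul, ← this, dotProduct_mulVec x,
    vecMul_transpose]

theorem bil_mulVec_of_mem {g : GSp4 R} (hg : g ∈ Sp4 R) (x y : Fin 2 ⊕ Fin 2 → R) :
    bil (g.1.val *ᵥ x) (g.1.val *ᵥ y) = bil x y := by
  rw [bil_mulVec, mem_Sp4_iff.1 hg, Units.val_one, one_mul]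

theorem bil_self (x : Fin 2 ⊕ Fin 2 → R) : bil x x = 0 := by simp [bil]; ring

theorem bil_sub (x y z : Fin 2 ⊕ Fin 2 → R) : bil x (y - z) = bil x y - bil x z := by
  simp [bil]; ring

/-- The matrix of the transvection `x ↦ x + a ⟨x, v⟩ v`. -/
def transvecMat (v : Fin 2 ⊕ Fin 2 → R) (a : R) : Matrix (Fin 2 ⊕ Fin 2) (Fin 2 ⊕ Fin 2) R :=
  1 + a • vecMulVec v (J (Fin 2) R *ᵥ v)

theorem transvecMat_mulVec (v : Fin 2 ⊕ Fin 2 → R) (a : R) (x : Fin 2 ⊕ Fin 2 → R) :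
    transvecMat v a *ᵥ x = x + (a * bil x v) • v := by
  rw [transvecMat, add_mulVec, one_mulVec, smul_mulVec, vecMulVec_mulVec, bil_eq, dotProduct_comm]
  ext i
  simp
  ring

theorem ext_mulVec {n : Type*} [Fintype n] [DecidableEq n] {A B : Matrix n n R}
    (h : ∀ x, A *ᵥ x = B *ᵥ x) : A = B := by
  ext i j
  simpa using congrFun (h (Pi.single j 1)) i

theorem transvecMat_mul (v : Fin 2 ⊕ Fin 2 → R) (a b : R) :
    transvecMat v a * transvecMat v b = transvecMat v (a + b) := by
  apply ext_mulVec
  intro x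
  rw [← mulVec_mulVec]
  simp only [transvecMat_mulVec]
  have : bil (x + (b * bil x v) • v) v = bil x v := by simp [bil]; ring
  rw [this]
  ext i
  simp
  ring

theorem transvecMat_zero (v : Fin 2 ⊕ Fin 2 → R) : transvecMat v 0 = 1 := by simp [transvecMat]

theorem transvecMat_symplectic (v : Fin 2 ⊕ Fin 2 → R) (a : R) :
    (transvecMat v a)ᵀ * J (Fin 2) R * transvecMat v a = J (Fin 2) R := by
  ext i j
  have e : ∀ A : Matrix (Fin 2 ⊕ Fin 2) (Fin 2 ⊕ Fin 2) R, ∀ i j,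
      (Aᵀ * J (Fin 2) R * A) i j = bil (A *ᵥ Pi.single i 1) (A *ᵥ Pi.single j 1) := by
    intro A i j
    rw [bil_eq, mulVec_single_one, mulVec_single_one, Matrix.mul_assoc]
    rfl
  have := e 1 i j
  simp only [transpose_one, Matrix.one_mul, Matrix.mul_one, one_mulVec] at this
  rw [e, this]
  simp only [transvecMat_mulVec]
  simp only [bil, Pi.add_apply, Pi.smul_apply, smul_eq_mul]
  ring

/-- The transvection `x ↦ x + a ⟨x, v⟩ v`. -/
def transvec (v : Fin 2 ⊕ Fin 2 → R) (a : R) : GSp4 R :=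
  ⟨⟨transvecMat v a, transvecMat v (-a), by rw [transvecMat_mul, add_neg_cancel, transvecMat_zero],
    by rw [transvecMat_mul, neg_add_cancel, transvecMat_zero]⟩, 1,
    by simpa using transvecMat_symplectic v a⟩

theorem transvec_val (v : Fin 2 ⊕ Fin 2 → R) (a : R) : (transvec v a).1.val = transvecMat v a := rfl

theorem transvec_mem_Sp4 (v : Fin 2 ⊕ Fin 2 → R) (a : R) : transvec v a ∈ Sp4 R :=
  mem_Sp4_iff.2 (mult_eq_of_spec (by simpa [transvec_val] using transvecMat_symplectic v a))

/-- The factor `mult g` compensates for the scaling of the form by g. -/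
theorem conj_transvec (g : GSp4 R) (v : Fin 2 ⊕ Fin 2 → R) (a : R) :
    g * transvec v (mult g * a) * g⁻¹ = transvec (g.1.val *ᵥ v) a := by
  rw [mul_inv_eq_iff_eq_mul]
  apply ext_val
  apply ext_mulVec
  intro x
  rw [mul_val, mul_val, ← mulVec_mulVec, ← mulVec_mulVec, transvec_val, transvec_val,
    transvecMat_mulVec, transvecMat_mulVec, bil_mulVec, mulVec_add, mulVec_smul]
  congr 2
  ring

/-- The matrix of `heis n s t`. -/
def heisMat (n s t : R) : Matrix (Fin 2 ⊕ Fin 2) (Fin 2 ⊕ Fin 2) R :=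
  fromBlocks !![1, n; 0, 1] !![s, t; t, 0] 0 !![1, 0; -n, 1]

theorem heisMat_mul (n s t n' s' t' : R) : heisMat n s t * heisMat n' s' t' =
    heisMat (n + n') (s + s' + n * t' - t * n') (t + t') := by
  simp only [heisMat, fromBlocks_multiply]
  congr 1 <;> ext i j <;> fin_cases i <;> fin_cases j <;>
    simp <;> ring

theorem heisMat_zero : heisMat (0 : R) 0 0 = 1 := by
  rw [← fromBlocks_one]
  simp only [heisMat]
  congr 1 <;> ext i j <;> fin_cases i <;> fin_cases j <;> simp

theorem heisMat_symplectic (n s t : R) :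
    (heisMat n s t)ᵀ * J (Fin 2) R * heisMat n s t = J (Fin 2) R := by
  simp only [heisMat, J, fromBlocks_transpose, fromBlocks_multiply]
  congr 1 <;> ext i j <;> fin_cases i <;> fin_cases j <;>
    simp [Matrix.mul_apply, Fin.sum_univ_succ] <;> ring

/-- The unipotent radical of the stabilizer of a line: a Heisenberg group. -/
def heis (n s t : R) : GSp4 R :=
  ⟨⟨heisMat n s t, heisMat (-n) (-s) (-t), by
      rw [heisMat_mul, ← heisMat_zero]; congr 1 <;> ring, by
      rw [heisMat_mul, ← heisMat_zero]; congr 1 <;> ring⟩, 1,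
    by simpa using heisMat_symplectic n s t⟩

theorem heis_mul (n s t n' s' t' : R) : heis n s t * heis n' s' t' =
    heis (n + n') (s + s' + n * t' - t * n') (t + t') :=
  ext_val (heisMat_mul n s t n' s' t')

theorem heis_zero : heis (0 : R) 0 0 = 1 := ext_val heisMat_zero

theorem heis_inv (n s t : R) : (heis n s t)⁻¹ = heis (-n) (-s) (-t) := by
  rw [inv_eq_iff_mul_eq_one, heis_mul, ← heis_zero]
  congr 1 <;> ring

theorem heis_pow (n s t : R) (j : ℕ) : heis n s t ^ j = heis (j * n) (j * s) (j * t) := by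
  induction j with
  | zero => simp [heis_zero]
  | succ j ih =>
    rw [pow_succ, ih, heis_mul]
    push_cast
    congr 1 <;> ring

theorem map_heis (f : R →+* S) (n s t : R) : map f (heis n s t) = heis (f n) (f s) (f t) := by
  apply ext_val
  rw [map_val]
  change (heisMat n s t).map f = heisMat (f n) (f s) (f t)
  simp only [heisMat, fromBlocks_map]
  congr 1 <;> ext i j <;> fin_cases i <;> fin_cases j <;> simp

/-- The parameter 2 is a unit in ℤ_ℓ for odd ℓ, so this single commutator generates Sp₄(ℤ_ℓ) as far
as normal subgroups are concerned. -/
theorem commutator_heis : ⁅heis (1 : R) 0 0, heis (0 : R) 0 1⁆ = heis 0 2 0 := by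
  rw [commutatorElement_def, heis_inv, heis_inv, heis_mul, heis_mul, heis_mul]
  congr 1 <;> ring

theorem heis_eq_transvec (a : R) : heis 0 a 0 = transvec (Pi.single (.inl 0) 1) a := by
  apply ext_val
  ext i j
  rcases i with i | i <;> rcases j with j | j <;> fin_cases i <;> fin_cases j <;>
    simp [heis, heisMat, transvec, transvecMat, J, vecMulVec_apply]

/-- `diag(1, 1, μ, μ)`, an element with multiplier `μ`. -/
def scale (μ : Rˣ) : GSp4 R :=
  ⟨⟨fromBlocks 1 0 0 ((μ : R) • 1), fromBlocks 1 0 0 (((μ⁻¹ : Rˣ) : R) • 1),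
    by simp [fromBlocks_multiply, smul_smul], by simp [fromBlocks_multiply, smul_smul]⟩, μ,
    by simp [J, fromBlocks_multiply, fromBlocks_transpose, fromBlocks_smul]⟩

theorem mult_scale (μ : Rˣ) : mult (scale μ) = μ :=
  mult_eq_of_spec (by
    simp [scale, J, fromBlocks_multiply, fromBlocks_transpose, fromBlocks_smul])

theorem scale_mulVec (μ : Rˣ) : (scale μ).1.val *ᵥ Pi.single (.inl 0) 1 = Pi.single (.inl 0) 1 := by
  rw [mulVec_single_one]
  ext i
  rcases i with i | i <;> fin_cases i <;> simp [scale]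

/-- Transvections along the first basis vector with unit parameters are conjugate. -/
theorem conj_scale (μ : Rˣ) (a : R) :
    scale μ * heis 0 (μ * a) 0 * (scale μ)⁻¹ = heis 0 a 0 := by
  have := conj_transvec (scale μ) (Pi.single (.inl 0) 1) a
  rwa [scale_mulVec, mult_scale, ← heis_eq_transvec, ← heis_eq_transvec] at this

end Symplectic

/-! ### Generation of Sp₄ by transvections over a local ring -/

section Local

variable {R : Type*} [CommRing R]

/-- `N` contains all transvections along unimodular vectors. -/
def HasTransvec (N : Subgroup (GSp4 R)) : Prop :=
  ∀ v a, (∃ w, IsUnit (bil w v)) → transvec v a ∈ N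

/-- The transvection along w - u with parameter ⟨u, w⟩⁻¹ does this; it fixes every vector orthogonal
to w - u. -/
theorem HasTransvec.move {N : Subgroup (GSp4 R)} (hN : HasTransvec N) {u w : Fin 2 ⊕ Fin 2 → R}
    (h : IsUnit (bil u w)) : ∃ g ∈ N, g ∈ Sp4 R ∧ g.1.val *ᵥ u = w ∧
      ∀ x, bil x u = bil x w → g.1.val *ᵥ x = x := by
  have e : bil u (w - u) = bil u w := by rw [bil_sub, bil_self, sub_zero]
  obtain ⟨c, hc⟩ := h.exists_left_inv
  refine ⟨transvec (w - u) c, hN _ _ ⟨u, e ▸ h⟩, transvec_mem_Sp4 _ _, ?_, fun x hx => ?_⟩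
  · rw [transvec_val, transvecMat_mulVec, e, hc, one_smul]
    abel
  · rw [transvec_val, transvecMat_mulVec, bil_sub, hx, sub_self, mul_zero, zero_smul, add_zero]

/-- When ⟨u, w⟩ is not a unit, an intermediate vector v replaces the single transvection by two. -/
theorem HasTransvec.move_two {N : Subgroup (GSp4 R)} (hN : HasTransvec N)
    {u v w : Fin 2 ⊕ Fin 2 → R} (h : IsUnit (bil u v)) (h' : IsUnit (bil v w)) :
    ∃ g ∈ N, g ∈ Sp4 R ∧ g.1.val *ᵥ u = w ∧
      ∀ x, bil x u = bil x v → bil x v = bil x w → g.1.val *ᵥ x = x := by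
  obtain ⟨g, hg, hg1, hg2, hg3⟩ := hN.move h
  obtain ⟨k, hk, hk1, hk2, hk3⟩ := hN.move h'
  refine ⟨k * g, mul_mem hk hg, mul_mem hk1 hg1, ?_, fun x hx hx' => ?_⟩
  · rw [mul_val, ← mulVec_mulVec, hg2, hk2]
  · rw [mul_val, ← mulVec_mulVec, hg3 x hx, hk3 x hx']

variable [IsLocalRing R]

theorem isUnit_add_of_not {a b : R} (ha : ¬ IsUnit a) (hb : IsUnit b) : IsUnit (a + b) := by
  by_contra h
  have h1 : a ∈ IsLocalRing.maximalIdeal R := ha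
  have h2 : a + b ∈ IsLocalRing.maximalIdeal R := h
  exact ((Submodule.add_mem_iff_right _ h1).1 h2) hb

theorem HasTransvec.move_to_single {N : Subgroup (GSp4 R)} (hN : HasTransvec N)
    {u : Fin 2 ⊕ Fin 2 → R} (hu : ∃ w, IsUnit (bil w u)) :
    ∃ g ∈ N, g ∈ Sp4 R ∧ g.1.val *ᵥ u = Pi.single (.inl 0) 1 := by
  suffices h : ∃ v, IsUnit (bil u v) ∧ IsUnit (bil v (Pi.single (.inl 0) 1)) by
    obtain ⟨v, h, h'⟩ := h
    obtain ⟨g, h1, h2, h3, -⟩ := hN.move_two h h'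
    exact ⟨g, h1, h2, h3⟩
  -- The intermediate vector always has `inr 0` coordinate 1, which makes its pairing with the
  -- target a unit; a second basis vector is added to pick up the first unit coordinate of u.
  by_cases h1 : IsUnit (u (.inl 0))
  · exact ⟨Pi.single (.inr 0) 1, by simpa [bil] using h1, by simp [bil]⟩
  by_cases h2 : IsUnit (u (.inl 1))
  · refine ⟨Pi.single (.inr 0) 1 + Pi.single (.inr 1) 1, ?_, by simp [bil]⟩
    have := (isUnit_add_of_not h1 h2).neg
    rw [neg_add] at this
    simpa [bil, sub_eq_add_neg] using this
  by_cases h3 : IsUnit (u (.inr 1))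
  · refine ⟨Pi.single (.inr 0) 1 + Pi.single (.inl 1) 1, ?_, by simp [bil]⟩
    have := isUnit_add_of_not (mt (IsUnit.neg_iff _).1 h1) h3
    simpa [bil, sub_eq_add_neg, add_comm] using this
  by_cases h4 : IsUnit (u (.inr 0))
  · refine ⟨Pi.single (.inr 0) 1 + Pi.single (.inl 0) 1, ?_, by simp [bil]⟩
    have := isUnit_add_of_not (mt (IsUnit.neg_iff _).1 h1) h4
    simpa [bil, sub_eq_add_neg, add_comm] using this
  exfalso
  obtain ⟨w, hw⟩ := hu
  have m : ∀ i, ¬ IsUnit (u i) → ∀ c, c * u i ∈ IsLocalRing.maximalIdeal R :=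
    fun i hi c => Ideal.mul_mem_left _ _ hi
  have : bil w u ∈ IsLocalRing.maximalIdeal R :=
    sub_mem (sub_mem (add_mem (m _ h1 _) (m _ h2 _)) (m _ h4 _)) (m _ h3 _)
  exact this hw

/-- Over a local ring `Sp₄` is generated by transvections. -/
theorem HasTransvec.Sp4_le {N : Subgroup (GSp4 R)} (hN : HasTransvec N) : Sp4 R ≤ N := by
  set e1 : Fin 2 ⊕ Fin 2 → R := Pi.single (.inl 0) 1
  set e2 : Fin 2 ⊕ Fin 2 → R := Pi.single (.inl 1) 1
  set f1 : Fin 2 ⊕ Fin 2 → R := Pi.single (.inr 0) 1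
  set f2 : Fin 2 ⊕ Fin 2 → R := Pi.single (.inr 1) 1
  have b1 : ∀ x, bil e1 x = - x (.inr 0) := by intro x; simp [bil, e1]
  have b2 : ∀ x, bil e2 x = - x (.inr 1) := by intro x; simp [bil, e2]
  have b3 : ∀ x, bil f1 x = x (.inl 0) := by intro x; simp [bil, f1]
  have b4 : ∀ x, bil f2 x = x (.inl 1) := by intro x; simp [bil, f2]
  have step : ∀ {k g : GSp4 R}, k ∈ N → k * g ∈ N → g ∈ N :=
    fun hk h => (Subgroup.mul_mem_cancel_left N hk).1 h
  -- stabilizer of three basis vectors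
  have s3 : ∀ g ∈ Sp4 R, g.1.val *ᵥ e1 = e1 → g.1.val *ᵥ f1 = f1 → g.1.val *ᵥ e2 = e2 →
      g ∈ N := by
    intro g hg h1 h2 h3
    have c1 := bil_mulVec_of_mem hg e1 f2
    have c2 := bil_mulVec_of_mem hg f1 f2
    have c3 := bil_mulVec_of_mem hg e2 f2
    rw [h1, b1, b1] at c1
    rw [h2, b3, b3] at c2
    rw [h3, b2, b2] at c3
    have : g = transvec e2 ((g.1.val *ᵥ f2) (.inl 1)) := by
      apply ext_val
      rw [transvec_val]
      have key : ∀ j, g.1.val *ᵥ Pi.single j 1 =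
          transvecMat e2 ((g.1.val *ᵥ f2) (.inl 1)) *ᵥ Pi.single j 1 := by
        intro j
        rw [transvecMat_mulVec]
        rcases j with j | j <;> fin_cases j
        · exact h1.trans (by simp [bil, e1, e2])
        · exact h3.trans (by simp [bil, e2])
        · exact h2.trans (by simp [bil, f1, e2])
        · ext i
          change (g.1.val *ᵥ f2) i = (f2 + _ • e2) i
          have : bil (Pi.single (Sum.inr ((fun i => i) ⟨1, by decide⟩)) 1) e2 = (1 : R) := by
            simp [bil, e2]
          rw [this]
          rcases i with i | i <;> fin_cases i
          · simpa [f2, e2] using c2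
          · simp [f2, e2]
          · simpa [f2, e2] using c1
          · simpa [f2, e2] using c3
      ext i j
      simpa using congrFun (key j) i
    rw [this]
    exact hN _ _ ⟨f2, by simp [b4, e2]⟩
  -- stabilizer of a hyperbolic pair
  have s2 : ∀ g ∈ Sp4 R, g.1.val *ᵥ e1 = e1 → g.1.val *ᵥ f1 = f1 → g ∈ N := by
    intro g hg h1 h2
    set u := g.1.val *ᵥ e2 with hu
    have c1 := bil_mulVec_of_mem hg e1 e2
    have c2 := bil_mulVec_of_mem hg f1 e2
    rw [h1, b1, b1, ← hu] at c1
    rw [h2, b3, b3, ← hu] at c2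
    have hu1 : u (.inr 0) = 0 := by simpa [e2] using c1
    have hu2 : u (.inl 0) = 0 := by simpa [e2] using c2
    obtain ⟨k, hk, hk1, hk2, hk3, hk4⟩ : ∃ k ∈ N, k ∈ Sp4 R ∧ k.1.val *ᵥ u = e2 ∧
        k.1.val *ᵥ e1 = e1 ∧ k.1.val *ᵥ f1 = f1 := by
      by_cases h : IsUnit (u (.inr 1))
      · obtain ⟨k, hk, hk1, hk2, hk3⟩ := hN.move (u := u) (w := e2) (by simpa [bil, e2] using h)
        exact ⟨k, hk, hk1, hk2, hk3 _ (by simp [b1, hu1, e2]), hk3 _ (by simp [b3, hu2, e2])⟩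
      -- Otherwise all coordinates of u are nonunits, against ⟨u, g f2⟩ = ⟨e2, f2⟩ = -1.
      · have hu3 : IsUnit (u (.inl 1)) := by
          have c3 := bil_mulVec_of_mem hg e2 f2
          rw [← hu] at c3
          by_contra h'
          have m : ∀ i, ¬ IsUnit (u i) → ∀ c, u i * c ∈ IsLocalRing.maximalIdeal R :=
            fun i hi c => Ideal.mul_mem_right _ _ hi
          have m0 : ∀ i, u i = 0 → ∀ c, u i * c ∈ IsLocalRing.maximalIdeal R := by
            intro i hi c; rw [hi, zero_mul]; exact zero_mem _
          have : bil u (g.1.val *ᵥ f2) ∈ IsLocalRing.maximalIdeal R :=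
            sub_mem (sub_mem (add_mem (m0 _ hu1 _) (m _ h _)) (m0 _ hu2 _)) (m _ h' _)
          rw [c3, b2] at this
          exact this (by simp [f2])
        obtain ⟨k, hk, hk1, hk2, hk3⟩ := hN.move_two (u := u) (v := f2) (w := e2)
          (by simpa [bil, f2] using hu3) (by simp [bil, f2, e2])
        exact ⟨k, hk, hk1, hk2, hk3 _ (by simp [b1, hu1, f2]) (by simp [b1, f2, e2]),
          hk3 _ (by simp [b3, hu2, f2]) (by simp [b3, f2, e2])⟩
    apply step hk
    apply s3 _ (mul_mem hk1 hg)
    · rw [mul_val, ← mulVec_mulVec, h1, hk3]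
    · rw [mul_val, ← mulVec_mulVec, h2, hk4]
    · rw [mul_val, ← mulVec_mulVec, ← hu, hk2]
  -- stabilizer of a vector
  have s1 : ∀ g ∈ Sp4 R, g.1.val *ᵥ e1 = e1 → g ∈ N := by
    intro g hg h1
    set w := g.1.val *ᵥ f1 with hw
    have c1 := bil_mulVec_of_mem hg e1 f1
    rw [h1, b1, b1, ← hw] at c1
    have hw1 : w (.inr 0) = 1 := by simpa [f1] using c1
    obtain ⟨k, hk, hk1, hk2, hk3⟩ : ∃ k ∈ N, k ∈ Sp4 R ∧ k.1.val *ᵥ w = f1 ∧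
        k.1.val *ᵥ e1 = e1 := by
      by_cases h : IsUnit (w (.inl 0))
      · obtain ⟨k, hk, hk1, hk2, hk3⟩ := hN.move (u := w) (w := f1) (by simpa [bil, f1] using h)
        exact ⟨k, hk, hk1, hk2, hk3 _ (by simp [b1, hw1, f1])⟩
      -- The intermediate vector f1 + e1 has the same pairing with e1 as w and f1, so both
      -- transvections fix e1.
      · obtain ⟨k, hk, hk1, hk2, hk3⟩ := hN.move_two (u := w) (v := f1 + e1) (w := f1)
          (by
            have := isUnit_add_of_not (mt (IsUnit.neg_iff _).1 h) isUnit_one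
            simpa [bil, f1, e1, hw1, sub_eq_add_neg, add_comm] using this)
          (by simp [bil, f1, e1])
        exact ⟨k, hk, hk1, hk2, hk3 _ (by simp [b1, hw1, f1, e1]) (by simp [b1, f1, e1])⟩
    apply step hk
    apply s2 _ (mul_mem hk1 hg)
    · rw [mul_val, ← mulVec_mulVec, h1, hk3]
    · rw [mul_val, ← mulVec_mulVec, ← hw, hk2]
  intro g hg
  obtain ⟨k, hk, hk1, hk2⟩ := hN.move_to_single (u := g.1.val *ᵥ e1)
    ⟨g.1.val *ᵥ f1, by rw [bil_mulVec_of_mem hg]; simp [bil, f1, e1]⟩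
  apply step hk
  apply s1 _ (mul_mem hk1 hg)
  rw [mul_val, ← mulVec_mulVec, hk2]

/-- Conjugation by `scale` changes the parameter by any unit, a nonunit a is the sum of the units a
+ 1 and -1, and conjugation by Sp₄ moves the first basis vector to any unimodular one. -/
theorem Sp4_le_of_heis_mem {N : Subgroup (GSp4 R)} [N.Normal] {b : R} (hb : IsUnit b)
    (h : heis 0 b 0 ∈ N) : Sp4 R ≤ N := by
  have unit : ∀ a : R, IsUnit a → heis 0 a 0 ∈ N := by
    intro a ha
    obtain ⟨b, rfl⟩ := hb
    obtain ⟨a, rfl⟩ := ha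
    have := conj_scale (b * a⁻¹) (a : R)
    rw [← this]
    refine Subgroup.Normal.conj_mem inferInstance _ ?_ _
    simpa using h
  have all : ∀ a : R, heis 0 a 0 ∈ N := by
    intro a
    by_cases ha : IsUnit a
    · exact unit a ha
    · have := mul_mem (unit _ (isUnit_add_of_not ha isUnit_one)) (unit _ (isUnit_one (M := R)).neg)
      rw [heis_mul] at this
      simpa using this
  refine HasTransvec.Sp4_le fun v a hv => ?_
  -- The conjugating element need not lie in the normal subgroup N, so `⊤` may be used here and
  -- there is no circularity.
  obtain ⟨g, -, hg, hgv⟩ :=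
    HasTransvec.move_to_single (N := ⊤) (fun _ _ _ => Subgroup.mem_top _) hv
  have := conj_transvec g v a
  rw [hgv, ← heis_eq_transvec, mem_Sp4_iff.1 hg, Units.val_one, one_mul] at this
  have h2 := all a
  rw [← this] at h2
  have := Subgroup.Normal.conj_mem (inferInstance : N.Normal) _ h2 g⁻¹
  simpa [mul_assoc] using this

/-! ### Commutator subgroups of the local factors -/

theorem Sp4_le_commutator (h2 : IsUnit (2 : R)) : Sp4 R ≤ commutator (GSp4 R) := by
  apply Sp4_le_of_heis_mem (isUnit_one (M := R))
  have h := conj_scale h2.unit (1 : R)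
  rw [mul_one, IsUnit.unit_spec] at h
  have e : (heis (0 : R) 1 0)⁻¹ = ⁅scale h2.unit, heis (0 : R) 2 0⁆ * ((heis 0 1 0)⁻¹ * heis 0 1 0) := by
    rw [commutatorElement_def, h, heis_inv, heis_inv, heis_mul, heis_mul, heis_mul]
    congr 1 <;> ring
  rw [← inv_mem_iff, e, inv_mul_cancel, mul_one]
  exact Subgroup.commutator_mem_commutator (Subgroup.mem_top _) (Subgroup.mem_top _)

/-- A sign character that is nontrivial on a transvection cuts out the commutator subgroup
inside `Sp₄`. -/
theorem mem_commutator_of_character (χ : GSp4 R →* ℤˣ) (hχ : χ (heis 0 1 0) = -1)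
    {g : GSp4 R} (hg : g ∈ Sp4 R) (hg1 : χ g = 1) : g ∈ commutator (GSp4 R) := by
  set τ : GSp4 R := heis 0 1 0 with hτ
  -- `scale (-1)` conjugates τ⁻¹ to τ, so the class of τ has square 1.
  have hsq : Abelianization.of τ * Abelianization.of τ = 1 := by
    have h := congrArg Abelianization.of (conj_scale (-1 : Rˣ) (1 : R))
    have e : heis (0 : R) ((-1 : Rˣ) * 1) 0 = τ⁻¹ := by
      rw [hτ, heis_inv]; congr 1 <;> simp
    rw [map_mul, map_mul, mul_right_comm, ← map_mul, mul_inv_cancel, map_one, one_mul, e,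
      map_inv] at h
    nth_rewrite 1 [hτ, ← h]
    exact inv_mul_cancel _
  -- A preimage of a subgroup of an abelian group is normal, and this one contains τ.
  have hle : Sp4 R ≤ (Subgroup.zpowers (Abelianization.of τ)).comap Abelianization.of :=
    Sp4_le_of_heis_mem isUnit_one (Subgroup.mem_zpowers _)
  obtain ⟨j, hj⟩ := Subgroup.mem_zpowers_iff.1 (hle hg)
  have hs : (-1 : ℤˣ) ^ j = 1 := by
    have := congrArg (Abelianization.lift χ) hj
    rwa [map_zpow, Abelianization.lift_apply_of, Abelianization.lift_apply_of, hχ, hg1] at this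
  have hev : Even j := by
    by_contra h
    rw [Int.not_even_iff_odd] at h
    rw [h.neg_one_zpow] at hs
    exact absurd hs (by decide)
  obtain ⟨m, rfl⟩ := hev
  rw [_root_.zpow_add, ← mul_zpow, hsq, _root_.one_zpow] at hj
  rw [← Abelianization.ker_of]
  exact hj.symm

end Local

end GSp4

/-! ### Lifting commutators through Sylow subgroups -/

theorem IsPGroup.exists_pow_eq_one_of_mem {G : Type*} [Group G] {p : ℕ} {P : Subgroup G} (hP : IsPGroup p P)
    {x : G} (hx : x ∈ P) : ∃ n, x ^ p ^ n = 1 := by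
  obtain ⟨n, hn⟩ := hP ⟨x, hx⟩
  exact ⟨n, congrArg Subtype.val hn⟩

/-- If `φ : G → A` and `ψ i : G → B i` are homomorphisms to finite groups, the `p`-subgroups of
each `B i` are commutative, and `U` is a `p`-subgroup of the image of `φ`, then commutators of
elements of `U` lift to elements of `G` that are killed by all `ψ i`. -/
theorem exists_lift_commutator {G A ι : Type*} {B : ι → Type*} [Group G] [Group A]
    [∀ i, Group (B i)] [Finite A] [Finite ι] [∀ i, Finite (B i)] {p : ℕ} [Fact p.Prime]
    (φ : G →* A) (ψ : ∀ i, G →* B i)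
    (hB : ∀ i (P : Subgroup (B i)), IsPGroup p P → ∀ x ∈ P, ∀ y ∈ P, x * y = y * x)
    {U : Subgroup A} (hU : IsPGroup p U) (hφ : U ≤ φ.range) {x y : A} (hx : x ∈ U) (hy : y ∈ U) :
    ∃ g, φ g = ⁅x, y⁆ ∧ ∀ i, ψ i g = 1 := by
  let f : G →* A × ∀ i, B i := φ.prod (MonoidHom.pi ψ)
  let F : Subgroup (A × ∀ i, B i) := (U.comap φ).map f
  let π : F →* U := ((MonoidHom.fst A (∀ i, B i)).comp F.subtype).codRestrict U (by
    rintro ⟨-, g, hg, rfl⟩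
    exact hg)
  have hπ : Function.Surjective π := by
    rintro ⟨u, hu⟩
    obtain ⟨g, rfl⟩ := hφ hu
    exact ⟨⟨f g, g, hu, rfl⟩, rfl⟩
  obtain ⟨P⟩ : Nonempty (Sylow p F) := inferInstance
  -- The image of a Sylow subgroup under a surjection is Sylow, and U is its own Sylow p-subgroup.
  have hP : (P : Subgroup F).map π = ⊤ := by
    have h : (P.mapSurjective hπ : Subgroup U) = ⊤ :=
      ((P.mapSurjective hπ).3 (hU.of_equiv Subgroup.topEquiv.symm) le_top).symm
    exact h
  have lift : ∀ u ∈ U, ∃ q : F, q ∈ (P : Subgroup F) ∧ ∃ g, f g = q ∧ φ g = u := by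
    intro u hu
    obtain ⟨q, hq, hqu⟩ : (⟨u, hu⟩ : U) ∈ (P : Subgroup F).map π := hP ▸ Subgroup.mem_top _
    obtain ⟨g, hg, hgq⟩ := q.2
    refine ⟨q, hq, g, hgq, ?_⟩
    exact (congrArg Prod.fst hgq).trans (congrArg Subtype.val hqu)
  obtain ⟨qx, hqx, gx, hfx, rfl⟩ := lift x hx
  obtain ⟨qy, hqy, gy, hfy, rfl⟩ := lift y hy
  refine ⟨⁅gx, gy⁆, map_commutatorElement _ _ _, fun i => ?_⟩
  let β : F →* B i := (Pi.evalMonoidHom B i).comp ((MonoidHom.snd A (∀ i, B i)).comp F.subtype)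
  -- Both lifts lie in the p-group P, so their images in B i lie in one p-subgroup and commute.
  have hc := hB i _ (P.2.map β) _ ⟨qx, hqx, rfl⟩ _ ⟨qy, hqy, rfl⟩
  have ex : β qx = ψ i gx := by
    change (qx : A × ∀ i, B i).2 i = _
    rw [← hfx]; rfl
  have ey : β qy = ψ i gy := by
    change (qy : A × ∀ i, B i).2 i = _
    rw [← hfy]; rfl
  rw [map_commutatorElement, commutatorElement_eq_one_iff_mul_comm, ← ex, ← ey, hc]

/-! ### Abelian l-subgroups of GL₄(ℤ/pᵏ) for p < l -/

theorem not_cube_dvd_card_GL {p l : ℕ} (hp : p.Prime) (hl : l.Prime) (h : p < l) :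
    ¬ l ^ 3 ∣ ∏ i : Fin 4, (p ^ 4 - p ^ (i : ℕ)) := by
  have hlp : ¬ l ∣ p := fun hd => absurd (Nat.le_of_dvd hp.pos hd) (by omega)
  obtain ⟨q, rfl⟩ : ∃ q, p = q + 1 := ⟨p - 1, by have := hp.pos; omega⟩
  have hq : 0 < q := by have := hp.two_le; omega
  have hlq : ¬ l ∣ q := fun hd => absurd (Nat.le_of_dvd hq hd) (by omega)
  set p := q + 1 with hpq
  have e : ∏ i : Fin 4, (p ^ 4 - p ^ (i : ℕ)) =
      (p ^ 6 * q ^ 4) * ((p + 1) ^ 2 * ((p ^ 2 + p + 1) * (p ^ 2 + 1))) := by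
    have e0 : p ^ 4 - 1 = q * (p + 1) * (p ^ 2 + 1) := by
      rw [Nat.sub_eq_iff_eq_add (Nat.one_le_pow _ _ hp.pos), hpq]; ring
    have e1 : p ^ 4 - p = p * (q * (p ^ 2 + p + 1)) := by
      rw [Nat.sub_eq_iff_eq_add (Nat.le_self_pow (by norm_num) _), hpq]; ring
    have e2 : p ^ 4 - p ^ 2 = p ^ 2 * (q * (p + 1)) := by
      rw [Nat.sub_eq_iff_eq_add (Nat.pow_le_pow_right hp.pos (by norm_num)), hpq]; ring
    have e3 : p ^ 4 - p ^ 3 = p ^ 3 * q := by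
      rw [Nat.sub_eq_iff_eq_add (Nat.pow_le_pow_right hp.pos (by norm_num)), hpq]; ring
    have v : ((3 : Fin 4) : ℕ) = 3 := rfl
    simp only [Fin.prod_univ_four, Fin.val_zero, Fin.val_one, Fin.val_two, v, pow_zero, pow_one,
      e0, e1, e2, e3]
    ring
  have cp : ∀ {m}, ¬ l ∣ m → ∀ j i, Nat.Coprime (l ^ j) (m ^ i) := fun hm j i =>
    Nat.Coprime.pow _ _ ((Nat.Prime.coprime_iff_not_dvd hl).2 hm)
  rw [e]
  intro hd
  have hd := ((cp hlp 3 6).mul_right (cp hlq 3 4)).dvd_of_dvd_mul_left hd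
  by_cases h1 : l ∣ p + 1
  -- The primes are consecutive integers, hence 2 and 3, and 27 does not divide 9 · 7 · 5.
  · have hl1 : l = p + 1 := by
      have := Nat.le_of_dvd (by omega) h1
      omega
    have hp2 : p = 2 := by
      by_contra hp2
      have o1 := hp.eq_two_or_odd'.resolve_left hp2
      have o2 := hl.eq_two_or_odd'.resolve_left (by have := hp.two_le; omega)
      rw [hl1] at o2
      exact absurd o2 (by simpa using o1.add_one)
    rw [hl1, hp2] at hd
    norm_num at hd
  · have hd := (cp h1 3 2).dvd_of_dvd_mul_left hd
    -- At most one of p² + p + 1 and p² + 1 is divisible by l, since they differ by p; each is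
    -- smaller than (p + 1)² ≤ l².
    have small : ∀ m, 0 < m → m < l ^ 2 → ¬ l ^ 3 ∣ m := by
      intro m hm hml hd
      have := Nat.le_of_dvd hm hd
      have : l ^ 2 ≤ l ^ 3 := Nat.pow_le_pow_right hl.pos (by norm_num)
      omega
    have hsq : (p + 1) ^ 2 ≤ l ^ 2 := Nat.pow_le_pow_left h 2
    by_cases h2 : l ∣ p ^ 2 + 1
    · have h3 : ¬ l ∣ p ^ 2 + p + 1 := by
        intro h3
        have := (Nat.dvd_sub h3 h2)
        rw [show p ^ 2 + p + 1 - (p ^ 2 + 1) = p by omega] at this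
        exact hlp this
      have := cp h3 3 1
      rw [pow_one] at this
      exact small _ (by positivity) (by nlinarith [hp.pos]) (this.dvd_of_dvd_mul_left hd)
    · have := cp h2 3 1
      rw [pow_one] at this
      exact small _ (by positivity) (by nlinarith [hp.pos]) (this.dvd_of_dvd_mul_right hd)

/-- By the previous divisibility bound P has order 1, l or l², and groups of these orders are
abelian. -/
theorem commute_of_isPGroup_GL_field {p l : ℕ} [hp : Fact p.Prime] [hl : Fact l.Prime] (h : p < l)
    {P : Subgroup (GL (Fin 4) (ZMod p))} (hP : IsPGroup l P) {x y : GL (Fin 4) (ZMod p)}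
    (hx : x ∈ P) (hy : y ∈ P) : x * y = y * x := by
  obtain ⟨n, hn⟩ := IsPGroup.iff_card.1 hP
  have hd : l ^ n ∣ ∏ i : Fin 4, (p ^ 4 - p ^ (i : ℕ)) := by
    have := Subgroup.card_subgroup_dvd_card P
    rwa [hn, Matrix.card_GL_field, ZMod.card] at this
  have hn3 : n < 3 := by
    by_contra h'
    exact not_cube_dvd_card_GL hp.out hl.out h ((pow_dvd_pow l (by omega)).trans hd)
  suffices H : ∀ a b : P, a * b = b * a from congrArg Subtype.val (H ⟨x, hx⟩ ⟨y, hy⟩)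
  interval_cases n
  · have := (Nat.card_eq_one_iff_unique.1 hn).1
    exact fun a b => Subsingleton.elim _ _
  · have : IsCyclic P := isCyclic_of_prime_card (p := l) (by rwa [pow_one] at hn)
    exact fun a b => by
      obtain ⟨g, hg⟩ := IsCyclic.exists_generator (α := P)
      obtain ⟨i, rfl⟩ := Subgroup.mem_zpowers_iff.1 (hg a)
      obtain ⟨j, rfl⟩ := Subgroup.mem_zpowers_iff.1 (hg b)
      exact zpow_mul_comm _ _ _
  · exact (IsPGroup.isMulCommutative_of_card_eq_prime_sq hn).is_comm.comm

theorem pow_dvd_pow_sub_one (R : Type*) [CommRing R] (p : ℕ) (x : R) (k : ℕ) :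
    (p : R) ^ (k + 1) ∣ (1 + p * x) ^ p ^ k - 1 := by
  have := dvd_sub_pow_of_dvd_sub (R := R) (p := p) (a := 1 + p * x) (b := 1) (by simp) k
  simpa using this

/-- A need not be commutative, so the divisibility is taken in ℤ[X] and evaluated at N. -/
theorem one_add_pow_eq_one {A : Type*} [Ring A] {p k : ℕ} (h : (p : A) ^ k = 0) (N : A) :
    (1 + p * N) ^ p ^ k = 1 := by
  obtain ⟨c, hc⟩ := pow_dvd_pow_sub_one (Polynomial ℤ) p Polynomial.X k
  have := congrArg (Polynomial.aeval N) hc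
  simp only [map_sub, map_pow, map_add, map_one, map_mul, map_natCast, Polynomial.aeval_X] at this
  rw [pow_succ, h, zero_mul, zero_mul, sub_eq_zero] at this
  exact this

theorem GL_pow_eq_one {n : Type*} [Fintype n] [DecidableEq n] {p k : ℕ} [Fact p.Prime] (hk : k ≠ 0)
    {g : GL n (ZMod (p ^ k))}
    (h : GeneralLinearGroup.map (ZMod.castHom (dvd_pow_self p hk) (ZMod p)) g = 1) :
    g ^ p ^ k = 1 := by
  have hd : ∀ x : ZMod (p ^ k), ZMod.castHom (dvd_pow_self p hk) (ZMod p) x = 0 →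
      ∃ y, x = p * y := by
    intro x hx
    rw [← ZMod.natCast_zmod_val x, map_natCast, ZMod.natCast_eq_zero_iff] at hx
    obtain ⟨c, hc⟩ := hx
    exact ⟨c, by rw [← ZMod.natCast_zmod_val x, hc, Nat.cast_mul]⟩
  have hN : ∀ i j, ∃ y, (g.val - 1) i j = p * y := by
    intro i j
    apply hd
    have : ZMod.castHom (dvd_pow_self p hk) (ZMod p) (g.val i j) = (1 : Matrix n n (ZMod p)) i j :=
      congrArg (fun u : GL n (ZMod p) => u.val i j) h
    rw [Matrix.sub_apply, map_sub, this]
    simp only [Matrix.one_apply]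
    split_ifs
    · rw [map_one, sub_self]
    · rw [map_zero, sub_self]
  choose N hN using hN
  have e : g.val = 1 + (p : Matrix n n (ZMod (p ^ k))) * Matrix.of N := by
    rw [← sub_eq_iff_eq_add']
    ext i j
    rw [hN, ← nsmul_eq_mul, ← nsmul_eq_mul]
    rfl
  apply Units.ext
  rw [Units.val_pow_eq_pow_val, e, Units.val_one]
  apply one_add_pow_eq_one
  rw [← Nat.cast_pow, ← diagonal_natCast, ZMod.natCast_self, diagonal_zero]

/-- For primes `p < l`, the `l`-subgroups of `GL₄(ℤ/pᵏℤ)` are commutative. -/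
theorem commute_of_isPGroup_GL {p l k : ℕ} [hp : Fact p.Prime] [hl : Fact l.Prime] (h : p < l)
    {P : Subgroup (GL (Fin 4) (ZMod (p ^ k)))} (hP : IsPGroup l P)
    {x y : GL (Fin 4) (ZMod (p ^ k))} (hx : x ∈ P) (hy : y ∈ P) : x * y = y * x := by
  rcases eq_or_ne k 0 with rfl | hk
  · have : Subsingleton (ZMod (p ^ 0)) := by rw [pow_zero]; infer_instance
    exact Units.ext (Subsingleton.elim _ _)
  let ρ : GL (Fin 4) (ZMod (p ^ k)) →* GL (Fin 4) (ZMod p) :=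
    GeneralLinearGroup.map (ZMod.castHom (dvd_pow_self p hk) (ZMod p))
  have hc := commute_of_isPGroup_GL_field h (hP.map ρ) ⟨x, hx, rfl⟩ ⟨y, hy, rfl⟩
  -- By the field case the commutator lies in the kernel of reduction modulo p, where orders are
  -- powers of p; it also lies in the l-group P, hence is trivial.
  have h1 : ⁅x, y⁆ ^ p ^ k = 1 := by
    apply GL_pow_eq_one hk
    change ρ ⁅x, y⁆ = 1
    rwa [map_commutatorElement, commutatorElement_eq_one_iff_mul_comm]
  obtain ⟨m, hm⟩ := IsPGroup.exists_pow_eq_one_of_mem hP (mul_mem (mul_mem (mul_mem hx hy) (inv_mem hx))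
    (inv_mem hy))
  have hcop : Nat.Coprime (p ^ k) (l ^ m) :=
    Nat.Coprime.pow _ _ ((Nat.coprime_primes hp.out hl.out).2 h.ne)
  rw [← commutatorElement_eq_one_iff_mul_comm, ← orderOf_eq_one_iff]
  exact Nat.eq_one_of_dvd_coprimes hcop (orderOf_dvd_of_pow_eq_one h1)
    (orderOf_dvd_of_pow_eq_one hm)

theorem GSp4.commute_of_isPGroup {p l k : ℕ} [Fact p.Prime] [Fact l.Prime] (h : p < l)
    {P : Subgroup (GSp4 (ZMod (p ^ k)))} (hP : IsPGroup l P)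
    {x y : GSp4 (ZMod (p ^ k))} (hx : x ∈ P) (hy : y ∈ P) : x * y = y * x := by
  let e := Units.mapEquiv (Matrix.reindexAlgEquiv (ZMod (p ^ k)) (ZMod (p ^ k))
    (finSumFinEquiv : Fin 2 ⊕ Fin 2 ≃ Fin 4)).toMulEquiv
  let f : GSp4 (ZMod (p ^ k)) →* GL (Fin 4) (ZMod (p ^ k)) :=
    e.toMonoidHom.comp (GSp4 (ZMod (p ^ k))).subtype
  have hf : Function.Injective f := e.injective.comp Subtype.val_injective
  apply hf
  rw [map_mul, map_mul]
  exact commute_of_isPGroup_GL h (hP.map f) ⟨x, hx, rfl⟩ ⟨y, hy, rfl⟩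

/-! ### The sign at 2 and the components of GSp₄(Ẑ) -/

namespace GSp4

/-- The sign character of `GSp₄(ℤ₂)`. -/
noncomputable def sgnTwo : GSp4 ℤ_[(⟨2, Nat.prime_two⟩ : Nat.Primes)] →* ℤˣ :=
  Equiv.Perm.sign.comp (equivS6.toMonoidHom.comp (map (PadicInt.toZMod (p := 2))))

/-- The class of {0, 5} is the first basis vector, and a transposition acts as the transvection
along the class of its support. -/
theorem permHom_swap : ModTwo.permHom (Equiv.swap 0 5) = heis 0 1 0 := by
  apply ext_val
  change ModTwo.permMat (Equiv.swap 0 5) = heisMat 0 1 0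
  decide +kernel

theorem sgnTwo_heis : sgnTwo (heis 0 1 0) = -1 := by
  have h : equivS6 (heis 0 1 0) = Equiv.swap 0 5 := by
    rw [← permHom_swap]
    exact MulEquiv.symm_apply_apply (MulEquiv.ofBijective ModTwo.permHom _) _
  have e : sgnTwo (heis 0 1 0) =
      Equiv.Perm.sign (equivS6 (map (PadicInt.toZMod (p := 2)) (heis 0 1 0))) := rfl
  rw [e, map_heis, map_zero, map_one, h]
  exact Equiv.Perm.sign_swap (by decide)

theorem isUnit_two_padicInt {p : ℕ} [hp : Fact p.Prime] (h : p ≠ 2) : IsUnit (2 : ℤ_[p]) := by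
  by_contra hn
  rw [PadicInt.not_isUnit_iff, show (2 : ℤ_[p]) = ((2 : ℤ) : ℤ_[p]) by norm_num,
    PadicInt.norm_int_lt_one_iff_dvd] at hn
  exact h ((Nat.prime_dvd_prime_iff_eq hp.out Nat.prime_two).1 (by exact_mod_cast hn))

/-- `sgn` depends only on the 2-adic component, the one place where Sp₄ need not consist of
commutators. -/
theorem mem_commutator_of_mem_ker {x : GSp4 ZHat} (hs : sgn x = 1) (hm : mult x = 1)
    (p : Nat.Primes) : proj p x ∈ commutator (GSp4 ℤ_[(p : ℕ)]) := by
  have hx : proj p x ∈ Sp4 ℤ_[(p : ℕ)] := by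
    rw [mem_Sp4_iff, proj, mult_map, hm, map_one]
  by_cases hp : p = ⟨2, Nat.prime_two⟩
  · subst hp
    exact mem_commutator_of_character sgnTwo sgnTwo_heis hx hs
  · exact Sp4_le_commutator (isUnit_two_padicInt fun h => hp (Subtype.ext h)) hx

theorem ext_map_eval {A B : Matrix (Fin 2 ⊕ Fin 2) (Fin 2 ⊕ Fin 2) ZHat}
    (h : ∀ p, A.map (Pi.evalRingHom (fun q : Nat.Primes => ℤ_[(q : ℕ)]) p) =
      B.map (Pi.evalRingHom (fun q : Nat.Primes => ℤ_[(q : ℕ)]) p)) : A = B := by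
  ext i j p
  exact congrFun (congrFun (h p) i) j

/-- The matrix over `Ẑ` with given components. -/
def matOfPi (A : ∀ p : Nat.Primes, Matrix (Fin 2 ⊕ Fin 2) (Fin 2 ⊕ Fin 2) ℤ_[(p : ℕ)]) :
    Matrix (Fin 2 ⊕ Fin 2) (Fin 2 ⊕ Fin 2) ZHat :=
  of fun i j p => A p i j

theorem matOfPi_map (A : ∀ p : Nat.Primes, Matrix (Fin 2 ⊕ Fin 2) (Fin 2 ⊕ Fin 2) ℤ_[(p : ℕ)])
    (p : Nat.Primes) :
    (matOfPi A).map (Pi.evalRingHom (fun q : Nat.Primes => ℤ_[(q : ℕ)]) p) = A p := rfl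

theorem matOfPi_mul_eq_one
    {A B : ∀ p : Nat.Primes, Matrix (Fin 2 ⊕ Fin 2) (Fin 2 ⊕ Fin 2) ℤ_[(p : ℕ)]}
    (h : ∀ p, A p * B p = 1) : matOfPi A * matOfPi B = 1 :=
  ext_map_eval fun p => by
    rw [Matrix.map_mul, matOfPi_map, matOfPi_map, h, Matrix.map_one _ (map_zero _) (map_one _)]

/-- The element of `GSp₄(Ẑ)` with given components. -/
noncomputable def ofPi (g : ∀ p : Nat.Primes, GSp4 ℤ_[(p : ℕ)]) : GSp4 ZHat :=
  ⟨⟨matOfPi fun p => (g p).1.val, matOfPi fun p => (g p).1⁻¹.val,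
      matOfPi_mul_eq_one fun p => (g p).1.mul_inv, matOfPi_mul_eq_one fun p => (g p).1.inv_mul⟩,
    MulEquiv.piUnits.symm fun p => mult (g p), ext_map_eval fun p => by
      rw [Matrix.map_mul, Matrix.map_mul, map_J]
      refine (mult_spec (g p)).trans ?_
      ext i j
      have hJ := congrFun (congrFun (map_J (Fin 2)
        (Pi.evalRingHom (fun q : Nat.Primes => ℤ_[(q : ℕ)]) p)) i) j
      simp only [Matrix.map_apply] at hJ
      simp only [Matrix.map_apply, Matrix.smul_apply, smul_eq_mul, map_mul, hJ]
      rfl⟩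

theorem proj_ofPi (g : ∀ p : Nat.Primes, GSp4 ℤ_[(p : ℕ)]) (p : Nat.Primes) :
    proj p (ofPi g) = g p := ext_val rfl

/-- Reduction of the `p`-adic component modulo `pᵏ`. -/
noncomputable def red (k : ℕ) (p : Nat.Primes) : GSp4 ZHat →* GSp4 (ZMod ((p : ℕ) ^ k)) :=
  (map (PadicInt.toZModPow k)).comp (proj p)

/-! ### Approximation inside H, prime by prime -/

theorem exists_proj_eq {H : Subgroup (GSp4 ZHat)}
    (hproj : ∀ p : Nat.Primes, Sp4 ℤ_[(p : ℕ)] ≤ H.map (proj p))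
    (hsurj : Function.Surjective (fun h : H => (sgn h.1, mult h.1)))
    (p : Nat.Primes) (g : GSp4 ℤ_[(p : ℕ)]) : ∃ h ∈ H, proj p h = g := by
  obtain ⟨⟨h, hh⟩, e⟩ := hsurj (1, mult (ofPi (Function.update 1 p g)))
  have e2 : mult h = mult (ofPi (Function.update 1 p g)) := congrArg Prod.snd e
  have e3 : mult (proj p h) = mult g := by
    rw [proj, mult_map, e2, ← mult_map]
    exact congrArg mult ((proj_ofPi _ p).trans (Function.update_self ..))
  obtain ⟨s, hs, hs2⟩ := hproj p (show (proj p h)⁻¹ * g ∈ Sp4 ℤ_[(p : ℕ)] by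
    rw [mem_Sp4_iff, map_mul, map_inv, e3, inv_mul_cancel])
  exact ⟨h * s, mul_mem hh hs, by rw [map_mul, hs2, mul_inv_cancel_left]⟩

/-- `Sp₄(ℤ_ℓ)` is contained in `H`, modulo `ℓᵏ`, with trivial components at smaller primes. -/
theorem exists_approx_Sp4 {H : Subgroup (GSp4 ZHat)}
    (h : ∀ (p : Nat.Primes) (g : GSp4 ℤ_[(p : ℕ)]), ∃ h ∈ H, proj p h = g) (k : ℕ)
    (l : Nat.Primes) {g : GSp4 ℤ_[(l : ℕ)]} (hg : g ∈ Sp4 ℤ_[(l : ℕ)]) :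
    ∃ h ∈ H, red k l h = map (PadicInt.toZModPow k) g ∧
      ∀ p : Nat.Primes, (p : ℕ) < l → red k p h = 1 := by
  -- There is no prime below 2, so surjectivity onto the factor suffices.
  by_cases hl2 : (l : ℕ) = 2
  · obtain ⟨x, hx, rfl⟩ := h l g
    exact ⟨x, hx, rfl, fun p hp => absurd p.2.two_le (by omega)⟩
  let M : Subgroup (GSp4 ℤ_[(l : ℕ)]) :=
    { carrier := {g | ∃ h ∈ H, red k l h = map (PadicInt.toZModPow k) g ∧
        ∀ p : Nat.Primes, (p : ℕ) < l → red k p h = 1}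
      one_mem' := ⟨1, one_mem H, by simp, by simp⟩
      mul_mem' := by
        rintro a b ⟨x, hx, hx1, hx2⟩ ⟨y, hy, hy1, hy2⟩
        exact ⟨x * y, mul_mem hx hy, by rw [map_mul, map_mul, hx1, hy1],
          fun p hp => by rw [map_mul, hx2 p hp, hy2 p hp, one_mul]⟩
      inv_mem' := by
        rintro a ⟨x, hx, hx1, hx2⟩
        exact ⟨x⁻¹, inv_mem hx, by rw [map_inv, map_inv, hx1],
          fun p hp => by rw [map_inv, hx2 p hp, inv_one]⟩ }
  -- Normality holds because H surjects onto the whole factor at l.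
  have : M.Normal := ⟨by
    rintro a ⟨x, hx, hx1, hx2⟩ b
    obtain ⟨y, hy, rfl⟩ := h l b
    refine ⟨y * x * y⁻¹, mul_mem (mul_mem hy hx) (inv_mem hy), ?_, fun p hp => ?_⟩
    · rw [map_mul, map_mul, map_mul, map_mul, hx1, map_inv, map_inv]; rfl
    · rw [map_mul, map_mul, hx2 p hp, mul_one, ← map_mul, mul_inv_cancel, map_one]⟩
  refine Sp4_le_of_heis_mem (N := M) (isUnit_two_padicInt hl2) ?_ hg
  let U : Subgroup (GSp4 (ZMod ((l : ℕ) ^ k))) :=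
    { carrier := {g | ∃ n s t : ℤ_[(l : ℕ)], map (PadicInt.toZModPow k) (heis n s t) = g}
      one_mem' := ⟨0, 0, 0, by rw [heis_zero, map_one]⟩
      mul_mem' := by
        rintro _ _ ⟨n, s, t, rfl⟩ ⟨n', s', t', rfl⟩
        exact ⟨_, _, _, by rw [← map_mul, heis_mul]⟩
      inv_mem' := by
        rintro _ ⟨n, s, t, rfl⟩
        exact ⟨_, _, _, by rw [← map_inv, heis_inv]⟩ }
  -- Powers in the Heisenberg group multiply the three parameters, so exponent lᵏ kills everything
  -- modulo lᵏ.
  have hU : IsPGroup l U := by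
    rintro ⟨_, n, s, t, rfl⟩
    refine ⟨k, Subtype.ext ?_⟩
    change (map (PadicInt.toZModPow k) (heis n s t)) ^ (l : ℕ) ^ k = 1
    rw [map_heis, heis_pow, ZMod.natCast_self, zero_mul, zero_mul, zero_mul, heis_zero]
  have : Finite {p : Nat.Primes // (p : ℕ) < l} :=
    Finite.of_injective (fun p => (⟨p.1, p.2⟩ : Fin l))
      fun p q h => Subtype.ext (Subtype.ext (congrArg Fin.val h))
  obtain ⟨⟨x, hx⟩, hx1, hx2⟩ := exists_lift_commutator (p := l)
    (ι := {p : Nat.Primes // (p : ℕ) < l}) ((red k l).comp H.subtype)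
    (fun p => (red k p.1).comp H.subtype)
    (fun p P hP x hx y hy => commute_of_isPGroup p.2 hP hx hy) hU
    (by
      rintro _ ⟨n, s, t, rfl⟩
      obtain ⟨x, hx, hx1⟩ := h l (heis n s t)
      exact ⟨⟨x, hx⟩, congrArg (map (PadicInt.toZModPow k)) hx1⟩)
    ⟨1, 0, 0, rfl⟩ ⟨0, 0, 1, rfl⟩
  refine ⟨x, hx, ?_, fun p hp => hx2 ⟨p, hp⟩⟩
  rw [← commutator_heis, map_commutatorElement]
  exact hx1

/-- At the primes `p < n` and modulo `pᵏ`, `H` contains the commutator subgroup of each factor. -/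
def ContainsCommutators (H : Subgroup (GSp4 ZHat)) (k n : ℕ) : Prop :=
  ∀ p : Nat.Primes, (p : ℕ) < n → ∀ c ∈ commutator (GSp4 ℤ_[(p : ℕ)]),
    ∃ h ∈ H, red k p h = map (PadicInt.toZModPow k) c ∧
      ∀ q : Nat.Primes, (q : ℕ) < n → q ≠ p → red k q h = 1

/-- Some y in H has the same `sgn` and `mult` as g; the components of g y⁻¹ lie in the commutator
subgroups and are inserted one prime at a time. -/
theorem ContainsCommutators.exists_red_eq {H : Subgroup (GSp4 ZHat)} {k n : ℕ}
    (hH : ContainsCommutators H k n)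
    (hsurj : Function.Surjective (fun h : H => (sgn h.1, mult h.1))) (g : GSp4 ZHat) :
    ∃ h ∈ H, ∀ p : Nat.Primes, (p : ℕ) < n → red k p h = red k p g := by
  obtain ⟨⟨y, hy⟩, e⟩ := hsurj (sgn g, mult g)
  have e1 : sgn y = sgn g := congrArg Prod.fst e
  have e2 : mult y = mult g := congrArg Prod.snd e
  have hx := mem_commutator_of_mem_ker (x := g * y⁻¹)
    (by rw [map_mul, map_inv, e1, mul_inv_cancel]) (by rw [map_mul, map_inv, e2, mul_inv_cancel])
  set x := g * y⁻¹ with hxdef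
  -- Triviality at the primes still to come is carried along, so that each new factor sets its
  -- component exactly.
  suffices H' : ∀ m ≤ n, ∃ h ∈ H, (∀ p : Nat.Primes, (p : ℕ) < m → red k p h = red k p x) ∧
      ∀ p : Nat.Primes, m ≤ (p : ℕ) → (p : ℕ) < n → red k p h = 1 by
    obtain ⟨h, hh, h1, -⟩ := H' n le_rfl
    exact ⟨h * y, mul_mem hh hy, fun p hp => by
      rw [map_mul, h1 p hp, ← map_mul, hxdef, inv_mul_cancel_right]⟩
  intro m
  induction m with
  | zero => exact fun _ => ⟨1, one_mem H, fun p hp => absurd hp (by omega), by simp⟩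
  | succ m ih =>
    intro hm
    obtain ⟨h, hh, h1, h2⟩ := ih (by omega)
    by_cases hp : m.Prime
    · obtain ⟨l, rfl⟩ : ∃ l : Nat.Primes, (l : ℕ) = m := ⟨⟨m, hp⟩, rfl⟩
      obtain ⟨z, hz, hz1, hz2⟩ := hH l (by omega) _ (hx l)
      refine ⟨h * z, mul_mem hh hz, fun p hpm => ?_, fun p hpm hpn => ?_⟩
      · rw [map_mul]
        by_cases hpe : p = l
        · subst hpe
          rw [h2 _ le_rfl (by omega), one_mul, hz1]
          rfl
        · have : (p : ℕ) ≠ l := fun h => hpe (Subtype.ext h)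
          rw [h1 p (by omega), hz2 p (by omega) hpe, mul_one]
      · have : p ≠ l := by
          rintro rfl
          omega
        rw [map_mul, h2 p (by omega) hpn, hz2 p hpn this, mul_one]
    · refine ⟨h, hh, fun p hpm => h1 p ?_, fun p hpm hpn => h2 p (by omega) hpn⟩
      have : (p : ℕ) ≠ m := fun h => hp (h ▸ p.2)
      omega

/-- Lifts of a and b supported at p among the primes below l have uncontrolled components at l.
Their commutator has multiplier 1, so `exists_approx_Sp4` supplies a correction at l that is trivial
at the smaller primes. This is why only commutators are claimed. -/
theorem containsCommutators {H : Subgroup (GSp4 ZHat)}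
    (hproj : ∀ p : Nat.Primes, Sp4 ℤ_[(p : ℕ)] ≤ H.map (proj p))
    (hsurj : Function.Surjective (fun h : H => (sgn h.1, mult h.1))) (k n : ℕ) :
    ContainsCommutators H k n := by
  have hH := exists_proj_eq hproj hsurj
  induction n with
  | zero => exact fun p hp => absurd hp (by omega)
  | succ l ih =>
    by_cases hl : l.Prime
    swap
    · have ne : ∀ p : Nat.Primes, (p : ℕ) < l + 1 → (p : ℕ) < l := by
        intro p hp
        have : (p : ℕ) ≠ l := fun h => hl (h ▸ p.2)
        omega
      intro p hp c hc
      obtain ⟨h, h1, h2, h3⟩ := ih p (ne p hp) c hc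
      exact ⟨h, h1, h2, fun q hq => h3 q (ne q hq)⟩
    have lt : ∀ p : Nat.Primes, (p : ℕ) < l + 1 → p ≠ ⟨l, hl⟩ → (p : ℕ) < l := by
      intro p hp hne
      have : (p : ℕ) ≠ l := fun h => hne (Subtype.ext h)
      omega
    have hSp := fun g hg => exists_approx_Sp4 hH k ⟨l, hl⟩ (g := g) hg
    have comm_Sp4 : ∀ p : Nat.Primes, commutator (GSp4 ℤ_[(p : ℕ)]) ≤ Sp4 ℤ_[(p : ℕ)] :=
      fun p => Abelianization.commutator_subset_ker (mult (R := ℤ_[(p : ℕ)]))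
    intro p hp c hc
    by_cases hpl : p = ⟨l, hl⟩
    · subst hpl
      obtain ⟨h, h1, h2, h3⟩ := hSp _ (comm_Sp4 _ hc)
      exact ⟨h, h1, h2, fun q hq hne => h3 q (lt q hq hne)⟩
    let C : Subgroup (GSp4 ℤ_[(p : ℕ)]) :=
      { carrier := {c | ∃ h ∈ H, red k p h = map (PadicInt.toZModPow k) c ∧
          ∀ q : Nat.Primes, (q : ℕ) < l + 1 → q ≠ p → red k q h = 1}
        one_mem' := ⟨1, one_mem H, by simp, by simp⟩
        mul_mem' := by
          rintro a b ⟨x, hx, hx1, hx2⟩ ⟨y, hy, hy1, hy2⟩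
          exact ⟨x * y, mul_mem hx hy, by rw [map_mul, map_mul, hx1, hy1],
            fun p hp hne => by rw [map_mul, hx2 p hp hne, hy2 p hp hne, one_mul]⟩
        inv_mem' := by
          rintro a ⟨x, hx, hx1, hx2⟩
          exact ⟨x⁻¹, inv_mem hx, by rw [map_inv, map_inv, hx1],
            fun p hp hne => by rw [map_inv, hx2 p hp hne, inv_one]⟩ }
    suffices hC : commutator (GSp4 ℤ_[(p : ℕ)]) ≤ C from hC hc
    rw [commutator_def, Subgroup.commutator_le]
    rintro a - b -
    have approx : ∀ a : GSp4 ℤ_[(p : ℕ)], ∃ x ∈ H, red k p x = map (PadicInt.toZModPow k) a ∧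
        ∀ q : Nat.Primes, (q : ℕ) < l → q ≠ p → red k q x = 1 := by
      intro a
      obtain ⟨x, hx, hx1⟩ := ih.exists_red_eq hsurj (ofPi (Function.update 1 p a))
      refine ⟨x, hx, ?_, fun q hq hne => ?_⟩
      · rw [hx1 p (lt p hp hpl)]
        exact congrArg (map (PadicInt.toZModPow k)) ((proj_ofPi _ p).trans (Function.update_self ..))
      · rw [hx1 q hq]
        have : proj q (ofPi (Function.update 1 p a)) = 1 :=
          (proj_ofPi _ q).trans (Function.update_of_ne hne ..)
        rw [red, MonoidHom.comp_apply, this, map_one]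
    obtain ⟨x, hx, hx1, hx2⟩ := approx a
    obtain ⟨y, hy, hy1, hy2⟩ := approx b
    have hxy : ⁅x, y⁆ ∈ H := mul_mem (mul_mem (mul_mem hx hy) (inv_mem hx)) (inv_mem hy)
    obtain ⟨z, hz, hz1, hz2⟩ := hSp (proj ⟨l, hl⟩ ⁅x, y⁆) (by
      rw [mem_Sp4_iff, map_commutatorElement, map_commutatorElement,
        commutatorElement_eq_one_iff_mul_comm, mul_comm])
    refine ⟨⁅x, y⁆ * z⁻¹, mul_mem hxy (inv_mem hz), ?_, fun q hq hne => ?_⟩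
    · rw [map_mul, map_inv, hz2 p (lt p hp hpl), map_commutatorElement, map_commutatorElement, hx1,
        hy1, inv_one, mul_one]
    · by_cases hql : q = ⟨l, hl⟩
      · subst hql
        rw [map_mul, map_inv, hz1]
        exact mul_inv_cancel _
      · have hql' := lt q hq hql
        rw [map_mul, map_inv, hz2 q hql', map_commutatorElement, hx2 q hql' hne,
          hy2 q hql' hne, commutatorElement_self, inv_one, mul_one]

open Filter Topology in
theorem tendsto_of_red_eq {h : ℕ → GSp4 ZHat} {x : GSp4 ZHat}
    (H : ∀ n (p : Nat.Primes), (p : ℕ) < n → red n p (h n) = red n p x) :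
    Tendsto h atTop (𝓝 x) := by
  have key : ∀ (h : ℕ → GSp4 ZHat) (x : GSp4 ZHat),
      (∀ n (p : Nat.Primes), (p : ℕ) < n → red n p (h n) = red n p x) →
      Tendsto (fun n => (h n).1.val) atTop (𝓝 x.1.val) := by
    intro h x H
    refine tendsto_pi_nhds.2 fun i => tendsto_pi_nhds.2 fun j => tendsto_pi_nhds.2 fun p => ?_
    rw [tendsto_iff_norm_sub_tendsto_zero]
    have hp : (1 : ℝ) < (p : ℕ) := by exact_mod_cast p.2.one_lt
    have hb : Tendsto (fun n : ℕ => ((p : ℕ) : ℝ)⁻¹ ^ n) atTop (𝓝 0) :=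
      tendsto_pow_atTop_nhds_zero_of_lt_one (by positivity) (inv_lt_one_of_one_lt₀ hp)
    refine squeeze_zero' (Eventually.of_forall fun n => norm_nonneg _) ?_ hb
    filter_upwards [eventually_gt_atTop (p : ℕ)] with n hn
    have e : PadicInt.toZModPow n ((h n).1.val i j p) = PadicInt.toZModPow n (x.1.val i j p) :=
      congrArg (fun g : GSp4 (ZMod ((p : ℕ) ^ n)) => g.1.val i j) (H n p hn)
    rw [← sub_eq_zero, ← map_sub, ← RingHom.mem_ker, PadicInt.ker_toZModPow,
      ← PadicInt.norm_le_pow_iff_mem_span_pow] at e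
    refine e.trans_eq ?_
    rw [inv_pow, _root_.zpow_neg, zpow_natCast]
  -- The topology of the unit group also requires convergence of the inverses, which satisfy the
  -- same congruences.
  rw [tendsto_subtype_rng, Units.isInducing_embedProduct.tendsto_nhds_iff]
  refine (key h x H).prodMk_nhds ((MulOpposite.continuous_op.tendsto _).comp ?_)
  exact key (fun n => (h n)⁻¹) x⁻¹ fun n p hp => by rw [map_inv, map_inv, H n p hp]

end GSp4

theorem lemma2p1 (H : Subgroup (GSp4 ZHat))
    (hclosed : IsClosed (H : Set (GSp4 ZHat)))
    (hproj : ∀ p : Nat.Primes, GSp4.Sp4 ℤ_[(p : ℕ)] ≤ H.map (GSp4.proj p))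
    (hsurj : Function.Surjective (fun h : H => (GSp4.sgn h.1, GSp4.mult h.1))) :
    H = ⊤ := by
  refine (Subgroup.eq_top_iff' H).2 fun x => ?_
  -- The precision and the bound on the primes grow together.
  choose h hh hx using fun n =>
    (GSp4.containsCommutators hproj hsurj n n).exists_red_eq hsurj x
  exact hclosed.mem_of_tendsto (GSp4.tendsto_of_red_eq hx) (Filter.Eventually.of_forall hh)
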